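/- Let $X=(V,E)$ be a finite digraph ($E\subseteq V\times V$, loops allowed) with vertices labeled $v_1,\dots,v_n$, and let $\overline X=(V,(V\times V)\setminus E)$. For a coloring $f:V\to\mathbb P=\{1,2,\dots\}$, a listing $s=(s_1,\dots,s_n)$ of all vertices without repetition is $(f,X)$-friendly if $f(s_1)\le\cdots\le f(s_n)$ and $f(s_j)<f(s_{j+1})$ whenever $(s_j,s_{j+1})\in E$. In noncommuting variables $x_1,x_2,\dots$ put $$W_X=\sum_{f:V\to\mathbb P}\#\{(f,X)\text{-friendly listings}\}\;x_{f(v_1)}x_{f(v_2)}\cdots x_{f(v_n)}.$$ Let $\Pi_n$ be the lattice of set partitions of $[n]$ ordered by refinement, with minimum $\widehat 0$ and Möbius function $\mu$. For $\pi\in\Pi_n$ let $m_\pi=\sum x_{i_1}\cdots x_{i_n}$ over all sequences of positive integers with $i_j=i_k$ if and only if $j,k$ are in the same block of $\pi$, and let $e_\pi=\sum x_{i_1}\cdots x_{i_n}$ over all sequences of positive integers with $i_j\ne i_k$ for all distinct $j,k$ in the same block of $\pi$. Let $\mathbb S_V(X,\overline X)$ be the set of permutations $\sigma$ of $V$ each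 of whose cycles (fixed points included) is a cycle of $X$ or a cycle of $\overline X$. For such $\sigma$ let $\varphi(\sigma)=\sum_\gamma(\ell(\gamma)-1)$, summed over the cycles $\gamma$ of $\sigma$ that are cycles of $X$, where $\ell(\gamma)$ is the length of $\gamma$, and let $\mathrm{Type}(\sigma)\in\Pi_n$ be the partition in which $j,k$ are in the same block if and only if $v_j,v_k$ are in the same cycle of $\sigma$. Then $(m_\pi)_{\pi\in\Pi_n}$ and $(e_\pi)_{\pi\in\Pi_n}$ are bases of the same complex vector space (the symmetric functions in noncommuting variables that are homogeneous of degree $n$), $W_X$ belongs to this space, and for every $\pi\in\Pi_n$ the coefficients of $m_\pi$ and of $e_\pi$ in the expansions of $W_X$ in these bases are $$[m_\pi]W_X=\sum_{\substack{\sigma\in\mathbb S_V(X,\overline X)\\ \mathrm{Type}(\sigma)\le\pi}}(-1)^{\varphi(\sigma)},\qquad [e_\pi]W_X=\sum_{\substack{\sigma\in\mathbb S_V(X,\overline X)\\ \pi\le\mathrm{Type}(\sigma)}}\frac{(-1)^{\varphi(\sigma)}\,\mu(\pi,\mathrm{Type}(\sigma))}{\mu(\widehat 0,\mathrm{Type}(\sigma))}.$$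 -/

import Mathlib

/-! ### Formal series in noncommuting variables -/

/-- Formal power series over `ℂ` in the noncommuting variables `x₁, x₂, …`, indexed by the
positive integers: a complex coefficient for every word. -/
abbrev NCSeries : Type := FreeMonoid ℕ+ → ℂ

open scoped Classical in
/-- The monomial `x_{i₁} x_{i₂} ⋯ x_{iₙ}`. -/
noncomputable def ncMonomial {n : ℕ} (i : Fin n → ℕ+) : NCSeries :=
  Pi.single (FreeMonoid.ofList (List.ofFn i)) 1

/-- The formal (possibly infinite) sum of a family of series, taken coefficient by coefficient.
In all the uses below every word occurs in only finitely many members of the family. -/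
noncomputable def ncSum {ι : Type*} (F : ι → NCSeries) : NCSeries :=
  fun w => ∑ᶠ a, F a w

/-- Every word occurs in at most one of the monomials `x_{i₁} ⋯ x_{iₙ}`, so coefficientwise
sums of multiples of these monomials are finite sums. -/
theorem ncMonomial_support_subsingleton {n : ℕ} (w : FreeMonoid ℕ+) :
    {i : Fin n → ℕ+ | ncMonomial i w ≠ 0}.Subsingleton := by
  have key : ∀ i : Fin n → ℕ+, ncMonomial i w ≠ 0 → w = FreeMonoid.ofList (List.ofFn i) := by
    intro i hi
    by_contra h
    exact hi (by simp [ncMonomial, h])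
  intro i hi j hj
  have h := (key i hi).symm.trans (key j hj)
  exact List.ofFn_injective (FreeMonoid.ofList.injective h)

/-! ### The lattice of set partitions -/

/-- The lattice `Πₙ` of set partitions of `[n]`. A set partition is given by the equivalence
relation "in the same block"; `π ≤ τ` says that `π` refines `τ`, and `⊥` is the partition into
singletons. -/
abbrev SetPartition (n : ℕ) : Type := Setoid (Fin n)

instance SetPartition.instFinite (n : ℕ) : Finite (SetPartition n) :=
  Finite.of_injective (fun (π : SetPartition n) (j k : Fin n) => π j k)
    (fun _ _ h => Setoid.ext fun j k => iff_of_eq (congrFun (congrFun h j) k))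

noncomputable instance SetPartition.instFintype (n : ℕ) : Fintype (SetPartition n) :=
  Fintype.ofFinite _

noncomputable instance SetPartition.instDecidableEq (n : ℕ) : DecidableEq (SetPartition n) :=
  Classical.decEq _

noncomputable instance SetPartition.instDecidableLE (n : ℕ) : DecidableLE (SetPartition n) :=
  Classical.decRel _

noncomputable instance SetPartition.instLocallyFiniteOrder (n : ℕ) :
    LocallyFiniteOrder (SetPartition n) :=
  LocallyFiniteOrder.ofFiniteIcc fun _ _ => Set.toFinite _

/-! ### Symmetric functions in noncommuting variables -/

/-- The monomial function `m_π`: the sum of `x_{i₁} ⋯ x_{iₙ}` over all sequences such that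
`i_j = i_k` if and only if `j` and `k` are in the same block of `π`. -/
noncomputable def ncM {n : ℕ} (π : SetPartition n) : NCSeries :=
  ncSum fun i : {i : Fin n → ℕ+ // ∀ j k, i j = i k ↔ π j k} => ncMonomial i.1

/-- The elementary function `e_π`: the sum of `x_{i₁} ⋯ x_{iₙ}` over all sequences such that
`i_j ≠ i_k` for any two distinct `j`, `k` in the same block of `π`. -/
noncomputable def ncE {n : ℕ} (π : SetPartition n) : NCSeries :=
  ncSum fun i : {i : Fin n → ℕ+ // ∀ j k, j ≠ k → π j k → i j ≠ i k} => ncMonomial i.1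

/-- The symmetric functions in noncommuting variables, homogeneous of degree `n`. -/
noncomputable def NCSym (n : ℕ) : Submodule ℂ NCSeries :=
  Submodule.span ℂ (Set.range (ncM (n := n)))

/-! ### The Redei–Berge function in noncommuting variables -/

/-- The listing `(s₁, …, sₙ)` of the vertices is `(f, X)`-friendly. -/
def IsFriendly {V : Type*} {n : ℕ} (X : Digraph V) (f : V → ℕ+) (s : Fin n ≃ V) : Prop :=
  ∀ (j : ℕ) (h : j + 1 < n),
    f (s ⟨j, Nat.lt_of_succ_lt h⟩) ≤ f (s ⟨j + 1, h⟩) ∧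
    (X.Adj (s ⟨j, Nat.lt_of_succ_lt h⟩) (s ⟨j + 1, h⟩) →
      f (s ⟨j, Nat.lt_of_succ_lt h⟩) < f (s ⟨j + 1, h⟩))

open scoped Classical in
/-- The function `W_X` of a digraph `X` whose vertices are labeled `v₁, …, vₙ`: the sum of
`δ_f(s) x_{f(v₁)} ⋯ x_{f(vₙ)}` over all colorings `f` and all listings `s` of the vertices. -/
noncomputable def redeiBerge {V : Type*} [Fintype V] {n : ℕ} (X : Digraph V) (v : Fin n ≃ V) :
    NCSeries :=
  ncSum fun f : V → ℕ+ =>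
    ∑ s : Fin n ≃ V, (if IsFriendly X f s then (1 : ℂ) else 0) • ncMonomial (fun j => f (v j))

/-! ### Permutations whose cycles lie in a digraph or in its complement -/

open scoped Classical in
/-- The cycles of `σ`, fixed points included, each given by its set of vertices. -/
noncomputable def permCycles {V : Type*} [Fintype V] (σ : Equiv.Perm V) : Finset (Finset V) :=
  Finset.univ.image fun u => Finset.univ.filter fun w => σ.SameCycle u w

/-- The cycle of `σ` with vertex set `γ` is a cycle of `X`. -/
def IsCycleIn {V : Type*} (X : Digraph V) (σ : Equiv.Perm V) (γ : Finset V) : Prop :=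
  ∀ u ∈ γ, X.Adj u (σ u)

open scoped Classical in
/-- `𝕊_V(X, X̄)`: the permutations each of whose cycles is a cycle of `X` or a cycle of the
complement of `X`. -/
noncomputable def digraphPerms {V : Type*} [Fintype V] (X : Digraph V) :
    Finset (Equiv.Perm V) :=
  Finset.univ.filter fun σ => ∀ γ ∈ permCycles σ, IsCycleIn X σ γ ∨ IsCycleIn Xᶜ σ γ

open scoped Classical in
/-- `φ(σ)`: the sum of `ℓ(γ) - 1` over the cycles `γ` of `σ` that are cycles of `X`. -/
noncomputable def permPhi {V : Type*} [Fintype V] (X : Digraph V) (σ : Equiv.Perm V) : ℕ :=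
  ∑ γ ∈ (permCycles σ).filter (fun γ => IsCycleIn X σ γ), (γ.card - 1)

/-- `Type(σ)`: the set partition of `[n]` whose blocks are the sets of labels of the cycles
of `σ`. -/
@[reducible] def permType {V : Type*} {n : ℕ} (v : Fin n ≃ V) (σ : Equiv.Perm V) : SetPartition n :=
  Setoid.comap v (Equiv.Perm.SameCycle.setoid σ)

/-! The coefficient of $W_X$ at a word involves a single coloring `f`, and a listing is friendly for
`f` exactly when no consecutive pair is an arc of `colorDigraph X f`. So the core is to count, for
an arbitrary digraph $Y$, the listings without consecutive arcs of $Y$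
(`sum_listings_eq_sum_digraphPerms`). Inclusion–exclusion turns this into a signed sum over sets $F$
of arcs of $Y$ of the number of listings in which all pairs of $F$ are consecutive. Only acyclic $F$
occur, and an acyclic $F$ lies in as many listings as permutations: $(n-|F|)!$ or $0$ of each
(`card_listings_eq_card_perms`). After exchanging sums, a permutation contributes the signed sum
over the acyclic sets of its arcs in $Y$. This factors over its cycles: a cycle of $Y$ gives
$(-1)^{\ell-1}$, a cycle of $\overline Y$ gives $1$, any other gives $0$.

For $Y$ = `colorDigraph X f`, colors are weakly monotone along every cycle of $Y$ or $\overline Y$,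
hence constant. What survives are the permutations in $\mathbb S_V(X,\overline X)$ whose type
refines the kernel of the coloring (`sum_isFriendly`). This is the $m$-expansion; regrouped, it says
$W_X=\sum_\sigma(-1)^{\varphi(\sigma)}p_{\mathrm{Type}(\sigma)}$.

For the $e$-expansion, Möbius inversion of $e_\pi=\sum_{\tau\le\pi}\mu(\widehat 0,\tau)p_\tau$
expresses $p_\tau$ through the $e_\pi$, provided $\mu(\widehat 0,\tau)\ne0$. The same count for the
complete digraph supplies this: $\mu(\widehat 0,\tau)$ is the sum of $(-1)^{\varphi(\sigma)}$ over
all $\sigma$ of type $\tau$, a nonempty sum of equal signs. -/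

/-! ### Listings that contain prescribed consecutive pairs -/

/-- A set of arcs without directed cycles: every nonempty set of vertices has a source. -/
def ArcAcyclic {V : Type*} (F : Finset (V × V)) : Prop :=
  ∀ A : Finset V, A.Nonempty → ∃ w ∈ A, ∀ u ∈ A, (u, w) ∉ F

theorem ArcAcyclic.mono {V : Type*} {F G : Finset (V × V)} (hG : ArcAcyclic G) (h : F ⊆ G) :
    ArcAcyclic F := fun A hA => by
  obtain ⟨w, hw, hu⟩ := hG A hA
  exact ⟨w, hw, fun u huA hF => hu u huA (h hF)⟩

theorem pair_infix_cons_iff {V : Type*} {u w a : V} {l : List V} :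
    [u, w] <:+: a :: l ↔ (u = a ∧ l.head? = some w) ∨ [u, w] <:+: l := by
  rw [List.infix_cons_iff]
  cases l <;> simp [List.cons_prefix_cons, eq_comm (a := w)]

/-- The listings of `S` in which every pair of `F` is consecutive. -/
def listingsWith {V : Type*} [DecidableEq V] (S : Finset V) (F : Finset (V × V)) :
    Finset (List V) :=
  S.val.lists.toFinset.filter fun l => ∀ p ∈ F, [p.1, p.2] <:+: l

theorem mem_listingsWith {V : Type*} [DecidableEq V] {S : Finset V} {F : Finset (V × V)}
    {l : List V} :
    l ∈ listingsWith S F ↔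
      (l.Nodup ∧ l.toFinset = S) ∧ ∀ p ∈ F, [p.1, p.2] <:+: l := by
  rw [listingsWith, Finset.mem_filter, Multiset.mem_toFinset, Multiset.mem_lists_iff]
  refine and_congr_left fun _ => ⟨fun h => ?_, fun h => ?_⟩
  · have hn : l.Nodup := by
      have := S.nodup
      rw [h] at this
      simpa using this
    refine ⟨hn, Finset.val_injective ?_⟩
    rw [h, List.toFinset_val, hn.dedup]
    rfl
  · rw [← h.2, List.toFinset_val, h.1.dedup]
    rfl

/-- A partial injection, seen as a set of arcs. -/
def IsPartialInj {V : Type*} (F : Finset (V × V)) : Prop :=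
  ∀ p ∈ F, ∀ q ∈ F, (p.1 = q.1 ↔ p.2 = q.2)

theorem IsPartialInj.mono {V : Type*} {F G : Finset (V × V)} (hG : IsPartialInj G) (h : F ⊆ G) :
    IsPartialInj F := fun p hp q hq => hG p (h hp) q (h hq)

theorem head_of_mem_listingsWith {V : Type*} [DecidableEq V] {S : Finset V}
    {F : Finset (V × V)} {h : V} {l : List V} (hl : h :: l ∈ listingsWith S F) (u : V) :
    (u, h) ∉ F := by
  intro hu
  rw [mem_listingsWith] at hl
  have h1 := hl.2 _ hu
  have hn := (List.nodup_cons.1 hl.1.1).1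
  rw [pair_infix_cons_iff] at h1
  rcases h1 with ⟨_, h1⟩ | h1
  · exact hn (List.mem_of_mem_head? h1)
  · exact hn (h1.subset (by simp))

open scoped Classical in
-- Remove the head `h`. If an arc `(h, e)` of `F` leaves `h`, the tail must start with `e` and that
-- arc is used up; otherwise the tail only has to contain `F`. The two cases need the second and the
-- first claim for smaller `S`, hence the joint induction. The total follows because possible heads
-- are the vertices that are not targets, `S.card - F.card` in number.
theorem card_listingsWith_aux {V : Type*} (m : ℕ) : ∀ (S : Finset V) (F : Finset (V × V)),
    S.card = m → IsPartialInj F → ArcAcyclic F → (∀ p ∈ F, p.1 ∈ S ∧ p.2 ∈ S) →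
    (listingsWith S F).card = (S.card - F.card).factorial ∧
    ∀ h ∈ S, (∀ u, (u, h) ∉ F) →
      ((listingsWith S F).filter fun l => l.head? = some h).card =
        (S.card - F.card - 1).factorial := by
  induction m with
  | zero =>
    intro S F hS _ _ hF
    obtain rfl := Finset.card_eq_zero.1 hS
    have hF0 : F = ∅ := Finset.eq_empty_of_forall_notMem fun p hp => by simpa using (hF p hp).1
    subst hF0
    refine ⟨?_, by simp⟩
    have : listingsWith (∅ : Finset V) ∅ = {[]} := by
      ext l
      simp +contextual [mem_listingsWith]
    simp [this]
  | succ m ih =>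
    intro S F hS hinj hac hF
    have key : ∀ h ∈ S, (∀ u, (u, h) ∉ F) →
      ((listingsWith S F).filter fun l => l.head? = some h).card =
        (S.card - F.card - 1).factorial := by
      intro h hh hsrc
      have hSc : (S.erase h).card = m := by rw [Finset.card_erase_of_mem hh, hS]; rfl
      have hcons : ∀ l : List V, ((h :: l).Nodup ∧ (h :: l).toFinset = S) ↔
          (l.Nodup ∧ l.toFinset = S.erase h) := by
        intro l
        rw [List.nodup_cons, List.toFinset_cons]
        constructor
        · rintro ⟨⟨h1, h2⟩, h3⟩
          refine ⟨h2, ?_⟩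
          rw [← h3, Finset.erase_insert (by simpa using h1)]
        · rintro ⟨h2, h3⟩
          refine ⟨⟨?_, h2⟩, by rw [h3, Finset.insert_erase hh]⟩
          rw [← List.mem_toFinset, h3]
          simp
      by_cases hd : ∃ e, (h, e) ∈ F
      · obtain ⟨e, he⟩ := hd
        have hF' : ∀ p ∈ F.erase (h, e), p.1 ∈ S.erase h ∧ p.2 ∈ S.erase h := by
          intro p hp
          obtain ⟨hne, hp⟩ := Finset.mem_erase.1 hp
          refine ⟨Finset.mem_erase.2 ⟨?_, (hF p hp).1⟩, Finset.mem_erase.2 ⟨?_, (hF p hp).2⟩⟩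
          · intro h1
            exact hne (Prod.ext h1 ((hinj p hp _ he).1 h1))
          · intro h2
            exact hsrc p.1 (h2 ▸ hp)
        have heh : e ≠ h := by
          rintro rfl
          exact hsrc _ he
        have hrec := (ih (S.erase h) (F.erase (h, e)) hSc
          (hinj.mono (Finset.erase_subset _ _)) (hac.mono (Finset.erase_subset _ _)) hF').2 e
          (Finset.mem_erase.2 ⟨heh, (hF _ he).2⟩) (by
            intro u hu
            obtain ⟨hne, hu⟩ := Finset.mem_erase.1 hu
            exact hne (Prod.ext ((hinj _ hu _ he).2 rfl) rfl))
        rw [hSc, Finset.card_erase_of_mem he] at hrec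
        have hpos : 0 < F.card := Finset.card_pos.2 ⟨_, he⟩
        rw [hS, show m + 1 - F.card - 1 = m - (F.card - 1) - 1 by omega, ← hrec]
        symm
        refine Finset.card_bij (fun l _ => h :: l) ?_ (by simp) ?_
        · intro l hl
          rw [Finset.mem_filter, mem_listingsWith] at hl ⊢
          refine ⟨⟨(hcons l).2 hl.1.1, fun p hp => ?_⟩, rfl⟩
          rw [pair_infix_cons_iff]
          by_cases hpe : p = (h, e)
          · subst hpe
            exact Or.inl ⟨rfl, hl.2⟩
          · exact Or.inr (hl.1.2 p (Finset.mem_erase.2 ⟨hpe, hp⟩))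
        · intro l hl
          rw [Finset.mem_filter, mem_listingsWith] at hl
          rcases l with _ | ⟨a, l⟩
          · simp at hl
          obtain rfl : a = h := by simpa using hl.2
          have hl1 := (hcons l).1 hl.1.1
          have hnot : ∀ w, ¬ [a, w] <:+: l := fun w hw => by
            have : a ∈ l.toFinset := List.mem_toFinset.2 (hw.subset (by simp))
            rw [hl1.2] at this
            simp at this
          refine ⟨l, ?_, rfl⟩
          rw [Finset.mem_filter, mem_listingsWith]
          refine ⟨⟨hl1, fun p hp => ?_⟩, ?_⟩
          · have h1 := hl.1.2 p (Finset.mem_of_mem_erase hp)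
            rw [pair_infix_cons_iff] at h1
            rcases h1 with ⟨h1, _⟩ | h1
            · exact absurd (hF' p hp).1 (by simp [h1])
            · exact h1
          · have h1 := hl.1.2 _ he
            rw [pair_infix_cons_iff] at h1
            exact (h1.resolve_right (hnot e)).2
      · push Not at hd
        have hF' : ∀ p ∈ F, p.1 ∈ S.erase h ∧ p.2 ∈ S.erase h := by
          intro p hp
          refine ⟨Finset.mem_erase.2 ⟨?_, (hF p hp).1⟩, Finset.mem_erase.2 ⟨?_, (hF p hp).2⟩⟩
          · rintro rfl
            exact hd _ hp
          · rintro rfl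
            exact hsrc _ hp
        have hrec := (ih (S.erase h) F hSc hinj hac hF').1
        rw [hSc] at hrec
        rw [hS, show m + 1 - F.card - 1 = m - F.card by omega, ← hrec]
        symm
        refine Finset.card_bij (fun l _ => h :: l) ?_ (by simp) ?_
        · intro l hl
          rw [Finset.mem_filter]
          rw [mem_listingsWith] at hl ⊢
          refine ⟨⟨(hcons l).2 hl.1, fun p hp => ?_⟩, rfl⟩
          rw [pair_infix_cons_iff]
          exact Or.inr (hl.2 p hp)
        · intro l hl
          rw [Finset.mem_filter, mem_listingsWith] at hl
          rcases l with _ | ⟨a, l⟩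
          · simp at hl
          obtain rfl : a = h := by simpa using hl.2
          refine ⟨l, ?_, rfl⟩
          rw [mem_listingsWith]
          refine ⟨(hcons l).1 hl.1.1, fun p hp => ?_⟩
          have h1 := hl.1.2 p hp
          rw [pair_infix_cons_iff] at h1
          rcases h1 with ⟨h1, _⟩ | h1
          · exact absurd (hF' p hp).1 (by simp [h1])
          · exact h1
    refine ⟨?_, key⟩
    have hsub : F.image Prod.snd ⊆ S := by
      intro w hw
      obtain ⟨p, hp, rfl⟩ := Finset.mem_image.1 hw
      exact (hF p hp).2
    have hcard : (S \ F.image Prod.snd).card = S.card - F.card := by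
      rw [Finset.card_sdiff_of_subset hsub, Finset.card_image_of_injOn]
      intro p hp q hq hpq
      exact Prod.ext ((hinj p hp q hq).2 hpq) hpq
    -- Acyclicity enters here: `S` itself has a source, so the truncated difference is positive and
    -- one factor of the factorial can be split off.
    have hpos : 0 < S.card - F.card := by
      rw [← hcard, Finset.card_pos]
      obtain ⟨w, hw, hu⟩ := hac S (Finset.card_pos.1 (by omega))
      refine ⟨w, Finset.mem_sdiff.2 ⟨hw, fun h => ?_⟩⟩
      obtain ⟨p, hp, rfl⟩ := Finset.mem_image.1 h
      exact hu p.1 (hF p hp).1 hp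
    have hU : listingsWith S F = (S \ F.image Prod.snd).biUnion fun h =>
        (listingsWith S F).filter fun l => l.head? = some h := by
      ext l
      simp only [Finset.mem_biUnion, Finset.mem_filter]
      refine ⟨fun hl => ?_, fun ⟨_, _, h, _⟩ => h⟩
      rcases l with _ | ⟨a, l⟩
      · have := (mem_listingsWith.1 hl).1.2
        rw [← this] at hS
        simp at hS
      · refine ⟨a, Finset.mem_sdiff.2 ⟨?_, fun h => ?_⟩, hl, rfl⟩
        · rw [← (mem_listingsWith.1 hl).1.2]
          simp
        · obtain ⟨p, hp, rfl⟩ := Finset.mem_image.1 h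
          exact head_of_mem_listingsWith hl p.1 hp
    rw [hU, Finset.card_biUnion]
    · rw [Finset.sum_congr rfl (fun h hh => key h (Finset.mem_sdiff.1 hh).1 (fun u hu =>
        (Finset.mem_sdiff.1 hh).2 (Finset.mem_image.2 ⟨_, hu, rfl⟩)))]
      rw [Finset.sum_const, hcard, smul_eq_mul, Nat.mul_factorial_pred hpos.ne']
    · intro a _ b _ hab
      rw [Function.onFun, Finset.disjoint_left]
      intro l ha hb
      rw [Finset.mem_filter] at ha hb
      exact hab (Option.some_injective _ (ha.2.symm.trans hb.2))

/-- The number of listings of a finite type in which every pair of an acyclic partial injection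
is consecutive. -/
theorem card_listingsWith {V : Type*} [Fintype V] [DecidableEq V] {F : Finset (V × V)} (hF : IsPartialInj F)
    (hac : ArcAcyclic F) :
    (listingsWith Finset.univ F).card = (Fintype.card V - F.card).factorial := by
  rw [← Finset.card_univ]
  convert (card_listingsWith_aux _ Finset.univ F rfl hF hac (by simp)).1

/-! ### Permutations that contain prescribed arcs -/

open scoped Classical in
-- `F` is a bijection from its sources to its targets, and its extensions correspond to the
-- bijections between the two complements, both of size `Fintype.card V - F.card`.
theorem card_perms_extending {V : Type*} [Fintype V] {F : Finset (V × V)}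
    (hF : IsPartialInj F) :
    (Finset.univ.filter fun σ : Equiv.Perm V => ∀ p ∈ F, σ p.1 = p.2).card =
      (Fintype.card V - F.card).factorial := by
  have hfst : Function.Injective fun p : F => p.1.1 := fun p q h =>
    Subtype.ext (Prod.ext h ((hF _ p.2 _ q.2).1 h))
  have hsnd : Function.Injective fun p : F => p.1.2 := fun p q h =>
    Subtype.ext (Prod.ext ((hF _ p.2 _ q.2).2 h) h)
  let e₀ : Set.range (fun p : F => p.1.1) ≃ Set.range (fun p : F => p.1.2) :=
    (Equiv.ofInjective _ hfst).symm.trans (Equiv.ofInjective _ hsnd)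
  have he : ∀ p : F, e₀ ⟨p.1.1, p, rfl⟩ = ⟨p.1.2, p, rfl⟩ := fun p => by
    have : (Equiv.ofInjective _ hfst).symm ⟨p.1.1, p, rfl⟩ = p :=
      (Equiv.ofInjective _ hfst).symm_apply_apply p
    simp only [e₀, Equiv.trans_apply, this]
    rfl
  have hc : ∀ f : F → V, Function.Injective f →
      Fintype.card ((Set.range f)ᶜ : Set V) = Fintype.card V - F.card := fun f hf => by
    rw [Fintype.card_compl_set, Set.card_range_of_injective hf, Fintype.card_coe]
  rw [← hc _ hfst, ← Fintype.card_equiv (Fintype.equivOfCardEq ((hc _ hfst).trans (hc _ hsnd).symm)),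
    ← Fintype.card_congr (Equiv.Set.compl e₀), Fintype.card_subtype]
  congr 1
  ext σ
  simp only [Finset.mem_filter, Finset.mem_univ, true_and]
  constructor
  · rintro h ⟨_, p, rfl⟩
    rw [he p]
    exact h p.1 p.2
  · intro h p hp
    rw [h ⟨p.1, ⟨p, hp⟩, rfl⟩, he ⟨p, hp⟩]

/-! ### Listings as bijections and as lists -/

theorem List.ofFn_toFinset_eq_univ {V : Type*} [Fintype V] [DecidableEq V] {n : ℕ}
    (s : Fin n ≃ V) : (List.ofFn s).toFinset = Finset.univ := by
  ext u
  simp [s.surjective u]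

theorem pair_infix_iff {V : Type*} {u w : V} {l : List V} :
    [u, w] <:+: l ↔ ∃ (j : ℕ) (h : j + 1 < l.length), l[j] = u ∧ l[j + 1] = w := by
  rw [List.infix_iff_getElem?]
  constructor
  · rintro ⟨k, hk, h⟩
    simp only [List.length_cons, List.length_nil] at hk
    have h0 := h 0 (by simp)
    have h1 := h 1 (by simp)
    refine ⟨k, by omega, ?_, ?_⟩
    · rw [List.getElem?_eq_some_iff] at h0
      simpa using h0.2
    · rw [List.getElem?_eq_some_iff] at h1
      simpa [add_comm] using h1.2
  · rintro ⟨j, h, rfl, rfl⟩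
    refine ⟨j, by simp; omega, fun i hi => ?_⟩
    simp only [List.length_cons, List.length_nil] at hi
    interval_cases i
    · simp
    · simp [add_comm]

theorem pair_infix_ofFn_iff {V : Type*} {n : ℕ} {s : Fin n → V} {u w : V} :
    [u, w] <:+: List.ofFn s ↔
      ∃ (j : ℕ) (h : j + 1 < n), s ⟨j, Nat.lt_of_succ_lt h⟩ = u ∧ s ⟨j + 1, h⟩ = w := by
  rw [pair_infix_iff]
  simp

/-- The arcs joining consecutive vertices of a listing. -/
def IsStep {V : Type*} {n : ℕ} (s : Fin n ≃ V) (p : V × V) : Prop :=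
  ∃ (j : ℕ) (h : j + 1 < n), s ⟨j, Nat.lt_of_succ_lt h⟩ = p.1 ∧ s ⟨j + 1, h⟩ = p.2

open scoped Classical in
theorem card_listings_eq {V : Type*} [Fintype V] {n : ℕ} (v : Fin n ≃ V) (F : Finset (V × V)) :
    (Finset.univ.filter fun s : Fin n ≃ V => ∀ p ∈ F, IsStep s p).card =
      (listingsWith Finset.univ F).card := by
  have hn : n = Fintype.card V := by simpa using Fintype.card_congr v
  refine Finset.card_bij (fun s _ => List.ofFn s) ?_ ?_ ?_
  · intro s hs
    rw [mem_listingsWith]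
    refine ⟨⟨List.nodup_ofFn.2 s.injective, List.ofFn_toFinset_eq_univ s⟩, fun p hp => ?_⟩
    exact pair_infix_ofFn_iff.2 ((Finset.mem_filter.1 hs).2 p hp)
  · intro s _ t _ h
    exact Equiv.coe_fn_injective (List.ofFn_injective h)
  · intro l hl
    rw [mem_listingsWith] at hl
    have hlen : l.length = n := by
      rw [hn, ← List.toFinset_card_of_nodup hl.1.1, hl.1.2, Finset.card_univ]
    subst hlen
    have hb : Function.Bijective l.get :=
      (Fintype.bijective_iff_injective_and_card _).2
        ⟨List.nodup_iff_injective_get.1 hl.1.1, by simpa using hn⟩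
    refine ⟨Equiv.ofBijective _ hb, ?_, by simp⟩
    rw [Finset.mem_filter]
    refine ⟨Finset.mem_univ _, fun p hp => ?_⟩
    obtain ⟨j, h, h1, h2⟩ := pair_infix_iff.1 (hl.2 p hp)
    exact ⟨j, h, h1, h2⟩

theorem isPartialInj_of_isStep {V : Type*} {n : ℕ} {s : Fin n ≃ V} {F : Finset (V × V)}
    (h : ∀ p ∈ F, IsStep s p) : IsPartialInj F := by
  intro p hp q hq
  obtain ⟨i, hi, h1, h2⟩ := h p hp
  obtain ⟨j, hj, h3, h4⟩ := h q hq
  rw [← h1, ← h2, ← h3, ← h4, s.injective.eq_iff, s.injective.eq_iff]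
  simp

theorem arcAcyclic_of_isStep {V : Type*} {n : ℕ} {s : Fin n ≃ V} {F : Finset (V × V)}
    (h : ∀ p ∈ F, IsStep s p) : ArcAcyclic F := by
  intro A hA
  obtain ⟨w, hw, hmin⟩ := A.exists_min_image s.symm hA
  refine ⟨w, hw, fun u hu hF => ?_⟩
  obtain ⟨j, hj, h1, h2⟩ := h _ hF
  have := hmin u hu
  simp only at h1 h2
  rw [← h1, ← h2, s.symm_apply_apply, s.symm_apply_apply, Fin.le_def] at this
  simp at this

theorem isPartialInj_of_perm {V : Type*} {σ : Equiv.Perm V} {F : Finset (V × V)}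
    (h : ∀ p ∈ F, σ p.1 = p.2) : IsPartialInj F := by
  intro p hp q hq
  rw [← h p hp, ← h q hq, σ.injective.eq_iff]

open scoped Classical in
/-- An acyclic set of arcs is contained in as many listings as permutations. -/
theorem card_listings_eq_card_perms {V : Type*} [Fintype V] {n : ℕ} (v : Fin n ≃ V)
    {F : Finset (V × V)} (hac : ArcAcyclic F) :
    (Finset.univ.filter fun s : Fin n ≃ V => ∀ p ∈ F, IsStep s p).card =
      (Finset.univ.filter fun σ : Equiv.Perm V => ∀ p ∈ F, σ p.1 = p.2).card := by
  by_cases hF : IsPartialInj F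
  · rw [card_listings_eq v, card_listingsWith hF hac, card_perms_extending hF]
  -- The steps of a listing and the arcs of a permutation both form partial injections, so otherwise
  -- both counts vanish.
  · rw [Finset.filter_false_of_mem fun s _ h => hF (isPartialInj_of_isStep h),
      Finset.filter_false_of_mem fun s _ h => hF (isPartialInj_of_perm h)]
    rfl

/-! ### Listings avoiding the arcs of a digraph -/

/-- Choosing a proper subset of each of several disjoint sets amounts to choosing a subset of their
union that contains none of them. -/
theorem prod_sum_ssubsets {ι R : Type*} [DecidableEq ι] [CommRing R] (w : ι → R)
    (P : Finset (Finset ι)) : (P : Set (Finset ι)).PairwiseDisjoint id →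
    ∏ γ ∈ P, ∑ A ∈ γ.ssubsets, ∏ u ∈ A, w u =
      ∑ A ∈ (P.sup id).powerset with ∀ γ ∈ P, ¬ γ ⊆ A, ∏ u ∈ A, w u := by
  induction P using Finset.induction_on with
  | empty => simp
  | insert γ P hγ ih =>
    intro hd
    have hd' : Disjoint γ (P.sup id) := by
      rw [Finset.disjoint_sup_right]
      intro δ hδ
      exact hd (by simp) (by simp [hδ]) (by rintro rfl; exact hγ hδ)
    have hle : ∀ δ ∈ P, δ ⊆ P.sup id := fun δ hδ => Finset.le_sup (f := id) hδ
    rw [Finset.prod_insert hγ, ih (hd.subset (by simp)), Finset.sum_mul_sum, ← Finset.sum_product',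
      Finset.sup_insert]
    simp only [id_eq, Finset.sup_eq_union]
    refine Finset.sum_nbij' (fun p => p.1 ∪ p.2) (fun C => (C ∩ γ, C ∩ P.sup id)) ?_ ?_ ?_ ?_ ?_
    · rintro ⟨A, B⟩ h
      simp only [Finset.mem_product, Finset.mem_filter, Finset.mem_powerset,
        Finset.mem_ssubsets] at h
      obtain ⟨hA, hB, hB'⟩ := h
      simp only [Finset.mem_filter, Finset.mem_powerset, Finset.mem_insert, forall_eq_or_imp]
      refine ⟨Finset.union_subset_union hA.1 hB, fun h => hA.2 fun u hu => ?_, fun δ hδ h =>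
        hB' δ hδ fun u hu => ?_⟩
      · rcases Finset.mem_union.1 (h hu) with h | h
        · exact h
        · exact absurd (hB h) (Finset.disjoint_left.1 hd' hu)
      · rcases Finset.mem_union.1 (h hu) with h | h
        · exact absurd (hle δ hδ hu) (Finset.disjoint_left.1 hd' (hA.1 h))
        · exact h
    · intro C hC
      simp only [Finset.mem_filter, Finset.mem_powerset, Finset.mem_insert,
        forall_eq_or_imp] at hC
      simp only [Finset.mem_product, Finset.mem_filter, Finset.mem_powerset,
        Finset.mem_ssubsets]
      refine ⟨⟨Finset.inter_subset_right, fun h => hC.2.1 fun u hu => Finset.mem_of_mem_inter_left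
        (h hu)⟩, Finset.inter_subset_right, fun δ hδ h => hC.2.2 δ hδ fun u hu =>
        Finset.mem_of_mem_inter_left (h hu)⟩
    · rintro ⟨A, B⟩ h
      simp only [Finset.mem_product, Finset.mem_filter, Finset.mem_powerset,
        Finset.mem_ssubsets] at h
      obtain ⟨hA, hB, hB'⟩ := h
      refine Prod.ext ?_ ?_
      · change (A ∪ B) ∩ γ = A
        rw [Finset.union_inter_distrib_right, Finset.inter_eq_left.2 hA.1,
          Finset.disjoint_iff_inter_eq_empty.1 (hd'.symm.mono_left hB), Finset.union_empty]
      · change (A ∪ B) ∩ P.sup id = B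
        rw [Finset.union_inter_distrib_right, Finset.inter_eq_left.2 hB,
          Finset.disjoint_iff_inter_eq_empty.1 (hd'.mono_left hA.1), Finset.empty_union]
    · intro C hC
      simp only [Finset.mem_filter, Finset.mem_powerset] at hC
      change C ∩ γ ∪ C ∩ P.sup id = C
      rw [← Finset.inter_union_distrib_left, Finset.inter_eq_left.2 hC.1]
    · rintro ⟨A, B⟩ h
      simp only [Finset.mem_product, Finset.mem_filter, Finset.mem_powerset,
        Finset.mem_ssubsets] at h
      exact (Finset.prod_union (Finset.disjoint_of_subset_left h.1.1
        (Finset.disjoint_of_subset_right h.2.1 hd'))).symm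

/-! ### Cycles of a permutation as vertex sets -/

section Cycles

variable {V : Type*} [Fintype V]

open scoped Classical in
theorem mem_permCycles {σ : Equiv.Perm V} {γ : Finset V} :
    γ ∈ permCycles σ ↔ ∃ u, (Finset.univ.filter fun w => σ.SameCycle u w) = γ := by
  simp [permCycles]

theorem permCycles_nonempty {σ : Equiv.Perm V} {γ : Finset V} (hγ : γ ∈ permCycles σ) :
    γ.Nonempty := by
  obtain ⟨u, rfl⟩ := mem_permCycles.1 hγ
  exact ⟨u, by simp [Equiv.Perm.SameCycle.refl]⟩

theorem mem_iff_sameCycle_of_mem_permCycles {σ : Equiv.Perm V} {γ : Finset V}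
    (hγ : γ ∈ permCycles σ) {u w : V} (hu : u ∈ γ) : w ∈ γ ↔ σ.SameCycle u w := by
  obtain ⟨x, rfl⟩ := mem_permCycles.1 hγ
  simp only [Finset.mem_filter, Finset.mem_univ, true_and] at hu ⊢
  exact ⟨fun h => hu.symm.trans h, fun h => hu.trans h⟩

theorem apply_mem_of_mem_permCycles {σ : Equiv.Perm V} {γ : Finset V}
    (hγ : γ ∈ permCycles σ) {u : V} (hu : u ∈ γ) : σ u ∈ γ :=
  (mem_iff_sameCycle_of_mem_permCycles hγ hu).2 ⟨1, by simp⟩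

theorem permCycles_pairwiseDisjoint (σ : Equiv.Perm V) :
    (permCycles σ : Set (Finset V)).PairwiseDisjoint id := by
  intro γ hγ δ hδ hne
  rw [Function.onFun, id, id, Finset.disjoint_left]
  intro u hu hu'
  refine hne (Finset.ext fun w => ?_)
  rw [mem_iff_sameCycle_of_mem_permCycles hγ hu, mem_iff_sameCycle_of_mem_permCycles hδ hu']

theorem exists_mem_permCycles (σ : Equiv.Perm V) (u : V) : ∃ γ ∈ permCycles σ, u ∈ γ :=
  ⟨_, mem_permCycles.2 ⟨u, rfl⟩, by simp [Equiv.Perm.SameCycle.refl]⟩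

theorem permCycles_sup [DecidableEq V] (σ : Equiv.Perm V) :
    (permCycles σ).sup id = Finset.univ := by
  refine Finset.eq_univ_iff_forall.2 fun u => ?_
  obtain ⟨γ, hγ, hu⟩ := exists_mem_permCycles σ u
  exact Finset.mem_sup.2 ⟨γ, hγ, hu⟩

/-- The arcs of a permutation that start in `A` are acyclic iff `A` contains no cycle. -/
theorem arcAcyclic_perm_iff {σ : Equiv.Perm V} {A : Finset V} {F : Finset (V × V)}
    (hF : ∀ p, p ∈ F ↔ p.1 ∈ A ∧ σ p.1 = p.2) :
    ArcAcyclic F ↔ ∀ γ ∈ permCycles σ, ¬ γ ⊆ A := by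
  constructor
  · intro h γ hγ hsub
    obtain ⟨w, hw, hu⟩ := h γ (permCycles_nonempty hγ)
    have hw' : σ⁻¹ w ∈ γ := (mem_iff_sameCycle_of_mem_permCycles hγ hw).2 ⟨-1, by simp⟩
    exact hu _ hw' ((hF _).2 ⟨hsub hw', by simp⟩)
  · intro h B hB
    by_contra! hcon
    -- If `B` has no source, each `w` in `B` receives an arc from `B`, which can only start at `σ⁻¹
    -- w`; so `B` is closed under `σ⁻¹`.
    have hback : ∀ w ∈ B, σ⁻¹ w ∈ B ∧ σ⁻¹ w ∈ A := by
      intro w hw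
      obtain ⟨u, hu, huF⟩ := hcon w hw
      obtain ⟨h1, h2⟩ := (hF _).1 huF
      simp only at h1 h2
      rw [← h2]
      simp [h1, hu]
    obtain ⟨b, hb⟩ := hB
    obtain ⟨γ, hγ, hbγ⟩ := exists_mem_permCycles σ b
    refine h γ hγ fun x hx => ?_
    have hpow : ∀ k : ℕ, (σ⁻¹ ^ k) b ∈ B := by
      intro k
      induction k with
      | zero => exact hb
      | succ k ih =>
        rw [pow_succ', Equiv.Perm.mul_apply]
        exact (hback _ ih).1
    -- Going backwards from `b` reaches `σ x`; one more step back puts `x` itself in `A`.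
    have hsc : (σ⁻¹).SameCycle b (σ x) := by
      rw [Equiv.Perm.sameCycle_inv]
      exact (mem_iff_sameCycle_of_mem_permCycles hγ hbγ).1 (apply_mem_of_mem_permCycles hγ hx)
    obtain ⟨k, hk⟩ := hsc.exists_nat_pow_eq
    have := (hback _ (hpow k)).2
    rw [hk] at this
    simpa using this

end Cycles

/-! ### Signed sums over acyclic sets of arcs -/

open scoped Classical in
/-- The weight `-1` on the arcs of a digraph, `0` elsewhere. -/
noncomputable def arcWeight {V : Type*} (Y : Digraph V) (p : V × V) : ℂ :=
  if Y.Adj p.1 p.2 then -1 else 0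

open scoped Classical in
-- The sum over proper subsets is $\prod(1+w)-\prod w$. On a cycle of `Y` the first product
-- vanishes, on a cycle of `Yᶜ` the second vanishes and the first is $1$, and on a mixed cycle both
-- vanish.
theorem sum_ssubsets_arcWeight {V : Type*} (Y : Digraph V) (σ : Equiv.Perm V)
    {γ : Finset V} (hγ : γ.Nonempty) :
    ∑ A ∈ γ.ssubsets, ∏ u ∈ A, arcWeight Y (u, σ u) =
      if IsCycleIn Y σ γ then (-1) ^ (γ.card - 1) else if IsCycleIn Yᶜ σ γ then 1 else 0 := by
  rw [Finset.ssubsets, Finset.sum_erase_eq_sub (Finset.mem_powerset_self γ),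
    ← Finset.prod_one_add]
  have hpos := Finset.card_pos.2 hγ
  obtain ⟨x, hx⟩ := hγ
  split_ifs with h1 h2
  · have hw : ∀ u ∈ γ, arcWeight Y (u, σ u) = -1 := fun u hu => by simp [arcWeight, h1 u hu]
    rw [Finset.prod_congr rfl hw, Finset.prod_eq_zero hx (by rw [hw x hx]; simp),
      Finset.prod_const]
    obtain ⟨k, hk⟩ := Nat.exists_eq_succ_of_ne_zero hpos.ne'
    rw [hk, Nat.succ_sub_one, pow_succ]
    ring
  · have hw : ∀ u ∈ γ, arcWeight Y (u, σ u) = 0 := fun u hu => by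
      have := h2 u hu
      rw [Digraph.compl_adj] at this
      simp [arcWeight, this]
    rw [Finset.prod_eq_one fun u hu => by rw [hw u hu, add_zero], Finset.prod_eq_zero hx (hw x hx),
      sub_zero]
  · simp only [IsCycleIn, Digraph.compl_adj] at h1 h2
    push Not at h1 h2
    obtain ⟨a, ha, ha'⟩ := h1
    obtain ⟨b, hb, hb'⟩ := h2
    rw [Finset.prod_eq_zero hb (by simp [arcWeight, hb']),
      Finset.prod_eq_zero ha (by simp [arcWeight, ha']), sub_zero]

open scoped Classical in
theorem prod_permCycles_arcWeight {V : Type*} [Fintype V] (Y : Digraph V) (σ : Equiv.Perm V) :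
    ∏ γ ∈ permCycles σ, ∑ A ∈ γ.ssubsets, ∏ u ∈ A, arcWeight Y (u, σ u) =
      if σ ∈ digraphPerms Y then (-1) ^ permPhi Y σ else 0 := by
  rw [Finset.prod_congr rfl fun γ hγ => sum_ssubsets_arcWeight Y σ (permCycles_nonempty hγ)]
  split_ifs with h
  · have h' := (Finset.mem_filter.1 h).2
    rw [permPhi, ← Finset.prod_pow_eq_pow_sum, Finset.prod_filter]
    refine Finset.prod_congr rfl fun γ hγ => ?_
    split_ifs with h1 h2
    · rfl
    · rfl
    · exact ((h' γ hγ).elim h1 h2).elim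
  · simp only [digraphPerms, Finset.mem_filter, Finset.mem_univ, true_and] at h
    push Not at h
    obtain ⟨γ, hγ, h1, h2⟩ := h
    exact Finset.prod_eq_zero hγ (by rw [if_neg h1, if_neg h2])

open scoped Classical in
-- A set of arcs of `σ` is determined by its set `A` of starting points and is acyclic exactly when
-- `A` contains no full cycle, so the product over cycles expands into these sets.
theorem sum_acyclic_subsets_perm {V : Type*} [Fintype V] (Y : Digraph V) (σ : Equiv.Perm V) :
    (if σ ∈ digraphPerms Y then (-1) ^ permPhi Y σ else 0) =
      ∑ F : Finset (V × V) with ArcAcyclic F,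
        if ∀ p ∈ F, σ p.1 = p.2 then ∏ p ∈ F, arcWeight Y p else 0 := by
  rw [← prod_permCycles_arcWeight, prod_sum_ssubsets _ _ (permCycles_pairwiseDisjoint σ),
    permCycles_sup, ← Finset.sum_filter]
  have hinj : ∀ A : Finset V, Set.InjOn (fun u => (u, σ u)) (A : Set V) :=
    fun A u _ w _ h => (Prod.ext_iff.1 h).1
  refine Finset.sum_nbij' (fun A => A.image fun u => (u, σ u)) (fun F => F.image Prod.fst)
    ?_ ?_ ?_ ?_ ?_
  · intro A hA
    simp only [Finset.mem_filter, Finset.mem_univ, true_and] at hA ⊢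
    refine ⟨(arcAcyclic_perm_iff (A := A) (σ := σ) ?_).2 hA.2, ?_⟩
    · rintro ⟨a, b⟩
      simp only [Finset.mem_image, Prod.mk.injEq]
      constructor
      · rintro ⟨u, hu, rfl, rfl⟩
        exact ⟨hu, rfl⟩
      · rintro ⟨h1, h2⟩
        exact ⟨a, h1, rfl, h2⟩
    · intro p hp
      obtain ⟨u, _, rfl⟩ := Finset.mem_image.1 hp
      rfl
  · intro F hF
    simp only [Finset.mem_filter, Finset.mem_univ, true_and, Finset.powerset_univ] at hF ⊢
    refine (arcAcyclic_perm_iff (F := F) ?_).1 hF.1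
    intro p
    constructor
    · intro hp
      exact ⟨Finset.mem_image_of_mem _ hp, hF.2 p hp⟩
    · rintro ⟨h1, h2⟩
      obtain ⟨q, hq, hqp⟩ := Finset.mem_image.1 h1
      have : q = p := Prod.ext hqp (by rw [← h2, ← hF.2 q hq, hqp])
      exact this ▸ hq
  · intro A _
    rw [Finset.image_image]
    exact Finset.image_id'
  · intro F hF
    simp only [Finset.mem_filter, Finset.mem_univ, true_and] at hF
    rw [Finset.image_image]
    refine (Finset.image_congr fun p hp => ?_).trans Finset.image_id
    exact Prod.ext rfl (hF.2 p hp)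
  · intro A _
    rw [Finset.prod_image (hinj A)]

open scoped Classical in
-- The indicator is the product of `1 + arcWeight Y p` over the steps `p`. Expanding it gives all
-- sets of steps, which are automatically acyclic.
theorem sum_subsets_listing {V : Type*} [Fintype V] {n : ℕ} (Y : Digraph V) (s : Fin n ≃ V) :
    (if ∀ p, IsStep s p → ¬ Y.Adj p.1 p.2 then (1 : ℂ) else 0) =
      ∑ F : Finset (V × V) with ArcAcyclic F,
        if ∀ p ∈ F, IsStep s p then ∏ p ∈ F, arcWeight Y p else 0 := by
  have h1 : (if ∀ p, IsStep s p → ¬ Y.Adj p.1 p.2 then (1 : ℂ) else 0) =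
      ∏ p with IsStep s p, (1 + arcWeight Y p) := by
    split_ifs with h
    · refine (Finset.prod_eq_one fun p hp => ?_).symm
      simp [arcWeight, h p (Finset.mem_filter.1 hp).2]
    · push Not at h
      obtain ⟨p, hp, hY⟩ := h
      exact (Finset.prod_eq_zero (Finset.mem_filter.2 ⟨Finset.mem_univ p, hp⟩)
        (by simp [arcWeight, hY])).symm
  rw [h1, Finset.prod_one_add, ← Finset.sum_filter]
  refine Finset.sum_congr (Finset.ext fun F => ?_) fun _ _ => rfl
  simp only [Finset.mem_powerset, Finset.mem_filter, Finset.mem_univ, true_and,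
    Finset.subset_iff]
  exact ⟨fun h => ⟨arcAcyclic_of_isStep fun p hp => h hp, fun p hp => h hp⟩,
    fun h _ hp => h.2 hp⟩

open scoped Classical in
/-- The number of listings without consecutive adjacent vertices, as a signed count of
permutations. -/
theorem sum_listings_eq_sum_digraphPerms {V : Type*} [Fintype V] {n : ℕ} (Y : Digraph V)
    (v : Fin n ≃ V) :
    ∑ s : Fin n ≃ V, (if ∀ p, IsStep s p → ¬ Y.Adj p.1 p.2 then (1 : ℂ) else 0) =
      ∑ σ ∈ digraphPerms Y, (-1) ^ permPhi Y σ := by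
  have h : ∑ σ ∈ digraphPerms Y, (-1 : ℂ) ^ permPhi Y σ =
      ∑ σ, if σ ∈ digraphPerms Y then (-1 : ℂ) ^ permPhi Y σ else 0 := by simp
  rw [h]
  simp_rw [sum_subsets_listing, sum_acyclic_subsets_perm]
  rw [Finset.sum_comm, Finset.sum_comm (s := Finset.univ (α := Equiv.Perm V))]
  refine Finset.sum_congr rfl fun F hF => ?_
  rw [← Finset.sum_filter, ← Finset.sum_filter, Finset.sum_const, Finset.sum_const,
    card_listings_eq_card_perms v (Finset.mem_filter.1 hF).2]

/-! ### Friendly listings -/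

/-- A function that weakly decreases along a cycle comes back to its starting value, so it never
drops. -/
theorem apply_eq_of_forall_apply_le {V α : Type*} [Fintype V] [PartialOrder α] {f : V → α}
    {σ : Equiv.Perm V} {γ : Finset V} (hγ : γ ∈ permCycles σ)
    (h : ∀ u ∈ γ, f (σ u) ≤ f u) : ∀ u ∈ γ, f (σ u) = f u := by
  intro u hu
  refine (h u hu).antisymm ?_
  have hσu := apply_mem_of_mem_permCycles hγ hu
  obtain ⟨k, hk⟩ := ((mem_iff_sameCycle_of_mem_permCycles hγ hσu).1 hu).exists_nat_pow_eq
  have key : ∀ k : ℕ, (σ ^ k) (σ u) ∈ γ ∧ f ((σ ^ k) (σ u)) ≤ f (σ u) := by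
    intro k
    induction k with
    | zero => exact ⟨hσu, le_rfl⟩
    | succ k ih =>
      rw [pow_succ', Equiv.Perm.mul_apply]
      exact ⟨apply_mem_of_mem_permCycles hγ ih.1, (h _ ih.1).trans ih.2⟩
  have := (key k).2
  rwa [hk] at this

/-- The arcs that decrease the color, or keep it and belong to `X`. -/
def colorDigraph {V : Type*} (X : Digraph V) (f : V → ℕ+) : Digraph V where
  Adj u w := f w < f u ∨ (f u = f w ∧ X.Adj u w)

theorem isFriendly_iff {V : Type*} {n : ℕ} (X : Digraph V) (f : V → ℕ+) (s : Fin n ≃ V) :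
    IsFriendly X f s ↔ ∀ p, IsStep s p → ¬ (colorDigraph X f).Adj p.1 p.2 := by
  have key : ∀ u w, (f u ≤ f w ∧ (X.Adj u w → f u < f w)) ↔ ¬ (colorDigraph X f).Adj u w := by
    intro u w
    simp only [colorDigraph, not_or, not_and, not_lt]
    constructor
    · exact fun h => ⟨h.1, fun he hX => (h.2 hX).ne he⟩
    · exact fun h => ⟨h.1, fun hX => lt_of_le_of_ne h.1 fun he => h.2 he hX⟩
  simp only [IsFriendly, key]
  constructor
  · rintro h p ⟨j, hj, h1, h2⟩
    rw [← h1, ← h2]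
    exact h j hj
  · exact fun h j hj => h (_, _) ⟨j, hj, rfl, rfl⟩

section

variable {V : Type*} [Fintype V] {X : Digraph V} {f : V → ℕ+} {σ : Equiv.Perm V} {γ : Finset V}

theorem isCycleIn_colorDigraph_iff (hγ : γ ∈ permCycles σ) :
    IsCycleIn (colorDigraph X f) σ γ ↔ IsCycleIn X σ γ ∧ ∀ u ∈ γ, f (σ u) = f u := by
  constructor
  · intro h
    have hf := apply_eq_of_forall_apply_le (f := f) hγ fun u hu =>
      (h u hu).elim le_of_lt fun h => h.1.ge
    exact ⟨fun u hu => ((h u hu).resolve_left (hf u hu).not_lt).2, hf⟩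
  · exact fun h u hu => Or.inr ⟨(h.2 u hu).symm, h.1 u hu⟩

theorem isCycleIn_compl_colorDigraph_iff (hγ : γ ∈ permCycles σ) :
    IsCycleIn (colorDigraph X f)ᶜ σ γ ↔ IsCycleIn Xᶜ σ γ ∧ ∀ u ∈ γ, f (σ u) = f u := by
  simp only [IsCycleIn, Digraph.compl_adj, colorDigraph, not_or, not_lt, not_and]
  constructor
  · intro h
    -- Along a cycle of the complement colors weakly increase, so the order is reversed.
    have hf : ∀ u ∈ γ, f (σ u) = f u := apply_eq_of_forall_apply_le
      (f := fun u => OrderDual.toDual (f u)) hγ fun u hu => (h u hu).1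
    exact ⟨fun u hu => (h u hu).2 (hf u hu).symm, hf⟩
  · exact fun h u hu => ⟨(h.2 u hu).ge, fun _ => h.1 u hu⟩

theorem mem_digraphPerms_colorDigraph :
    σ ∈ digraphPerms (colorDigraph X f) ↔ σ ∈ digraphPerms X ∧ ∀ u, f (σ u) = f u := by
  classical
  simp only [digraphPerms, Finset.mem_filter, Finset.mem_univ, true_and]
  constructor
  · intro h
    refine ⟨fun γ hγ => (h γ hγ).imp (fun h => ((isCycleIn_colorDigraph_iff hγ).1 h).1)
      fun h => ((isCycleIn_compl_colorDigraph_iff hγ).1 h).1, fun u => ?_⟩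
    obtain ⟨γ, hγ, hu⟩ := exists_mem_permCycles σ u
    exact (h γ hγ).elim (fun h => ((isCycleIn_colorDigraph_iff hγ).1 h).2 u hu)
      fun h => ((isCycleIn_compl_colorDigraph_iff hγ).1 h).2 u hu
  · exact fun h γ hγ => (h.1 γ hγ).imp
      (fun h' => (isCycleIn_colorDigraph_iff hγ).2 ⟨h', fun u _ => h.2 u⟩)
      fun h' => (isCycleIn_compl_colorDigraph_iff hγ).2 ⟨h', fun u _ => h.2 u⟩

theorem permPhi_colorDigraph (hf : ∀ u, f (σ u) = f u) :
    permPhi (colorDigraph X f) σ = permPhi X σ := by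
  classical
  refine Finset.sum_congr (Finset.filter_congr fun γ hγ => ?_) fun _ _ => rfl
  rw [isCycleIn_colorDigraph_iff hγ]
  exact and_iff_left fun u _ => hf u

theorem permType_le_ker_iff {n : ℕ} (v : Fin n ≃ V) :
    permType v σ ≤ Setoid.ker (fun j => f (v j)) ↔ ∀ u, f (σ u) = f u := by
  constructor
  · intro h u
    have : permType v σ (v.symm u) (v.symm (σ u)) := by
      rw [Setoid.comap_rel, v.apply_symm_apply, v.apply_symm_apply]
      exact ⟨1, by simp⟩
    have := h this
    rw [Setoid.ker_def] at this
    simpa using this.symm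
  · intro h j k hjk
    have hjk : σ.SameCycle (v j) (v k) := hjk
    obtain ⟨m, hm⟩ := hjk.exists_nat_pow_eq
    rw [Setoid.ker_def, ← hm]
    clear hm
    induction m with
    | zero => rfl
    | succ m ih => rw [pow_succ', Equiv.Perm.mul_apply, h, ih]

end

open scoped Classical in
/-- The number of friendly listings for a coloring depends only on its kernel. -/
theorem sum_isFriendly {V : Type*} [Fintype V] {n : ℕ} (X : Digraph V) (v : Fin n ≃ V)
    (f : V → ℕ+) :
    ∑ s : Fin n ≃ V, (if IsFriendly X f s then (1 : ℂ) else 0) =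
      ∑ σ ∈ digraphPerms X with permType v σ ≤ Setoid.ker (fun j => f (v j)),
        (-1 : ℂ) ^ permPhi X σ := by
  simp_rw [isFriendly_iff]
  rw [sum_listings_eq_sum_digraphPerms _ v]
  refine Finset.sum_congr (Finset.ext fun σ => ?_) fun σ hσ => ?_
  · rw [mem_digraphPerms_colorDigraph, Finset.mem_filter, permType_le_ker_iff]
  · rw [permPhi_colorDigraph]
    rw [Finset.mem_filter, permType_le_ker_iff] at hσ
    exact hσ.2

/-! ### The Möbius function of the partition lattice -/

theorem exists_ker_eq {n : ℕ} (π : SetPartition n) : ∃ k : Fin n → ℕ+, Setoid.ker k = π := by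
  refine ⟨fun j => (Finite.equivFin (Quotient π) ⟦j⟧).val.succPNat, Setoid.ext fun i j => ?_⟩
  rw [Setoid.ker_def, Nat.succPNat_inj, Fin.val_inj, (Finite.equivFin _).injective.eq_iff,
    Quotient.eq]

theorem permType_refl_rel {n : ℕ} {σ : Equiv.Perm (Fin n)} {i j : Fin n} :
    permType (Equiv.refl _) σ i j ↔ σ.SameCycle i j := Iff.rfl

/-- In the complete digraph every cycle counts, so only the vertex sets of the cycles matter. -/
theorem permPhi_top_congr {n : ℕ} {σ τ : Equiv.Perm (Fin n)}
    (h : permType (Equiv.refl _) σ = permType (Equiv.refl _) τ) :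
    permPhi ⊤ σ = permPhi ⊤ τ := by
  have hs : σ.SameCycle = τ.SameCycle := funext₂ fun i j => propext <| by
    rw [← permType_refl_rel, h, permType_refl_rel]
  have hc : permCycles σ = permCycles τ := by
    ext γ
    simp only [mem_permCycles, Finset.ext_iff, Finset.mem_filter, hs]
  have ht : ∀ (ρ : Equiv.Perm (Fin n)) (γ : Finset (Fin n)), IsCycleIn ⊤ ρ γ :=
    fun _ _ _ _ => trivial
  simp only [permPhi, ht, hc]

theorem digraphPerms_top {V : Type*} [Fintype V] (σ : Equiv.Perm V) :
    σ ∈ digraphPerms (⊤ : Digraph V) := by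
  classical
  exact Finset.mem_filter.2 ⟨Finset.mem_univ _, fun _ _ => Or.inl fun _ _ => trivial⟩

theorem isFriendly_top_iff {n : ℕ} {f : Fin n → ℕ+} {s : Fin n ≃ Fin n} :
    IsFriendly ⊤ f s ↔ StrictMono fun j => f (s j) := by
  cases n with
  | zero => exact ⟨fun _ i => i.elim0, fun _ j h => by omega⟩
  | succ n =>
    rw [Fin.strictMono_iff_lt_succ]
    constructor
    · exact fun h j => (h j.1 (by omega)).2 trivial
    · intro h j hj
      have := h ⟨j, by omega⟩
      exact ⟨this.le, fun _ => this⟩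

open scoped Classical in
-- By `sum_isFriendly` for the complete digraph, the left side counts the listings along which a
-- coloring with kernel `π` strictly increases: one if the coloring is injective, none otherwise.
theorem sum_permType_le_eq {n : ℕ} (π : SetPartition n) :
    ∑ σ : Equiv.Perm (Fin n) with permType (Equiv.refl _) σ ≤ π, (-1 : ℂ) ^ permPhi ⊤ σ =
      if π = ⊥ then 1 else 0 := by
  have key : ∀ f : Fin n → ℕ+,
      ∑ σ : Equiv.Perm (Fin n) with permType (Equiv.refl _) σ ≤ Setoid.ker f,
        (-1 : ℂ) ^ permPhi ⊤ σ =
      ∑ s : Fin n ≃ Fin n, (if StrictMono (fun j => f (s j)) then (1 : ℂ) else 0) := by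
    intro f
    have h : ∑ σ : Equiv.Perm (Fin n) with permType (Equiv.refl _) σ ≤ Setoid.ker f,
        (-1 : ℂ) ^ permPhi ⊤ σ = ∑ σ ∈ digraphPerms ⊤ with
          permType (Equiv.refl _) σ ≤ Setoid.ker (fun j => f (Equiv.refl _ j)),
        (-1 : ℂ) ^ permPhi ⊤ σ := by
      refine Finset.sum_congr (Finset.ext fun σ => ?_) fun _ _ => rfl
      rw [Finset.mem_filter, Finset.mem_filter]
      exact and_congr_left fun _ => iff_of_true (Finset.mem_univ σ) (digraphPerms_top σ)
    rw [h, ← sum_isFriendly ⊤ (Equiv.refl (Fin n)) f]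
    refine Finset.sum_congr (Finset.ext fun s => ?_) fun s _ =>
      if_congr isFriendly_top_iff rfl rfl
    rw [iff_true_intro (@Finset.mem_univ _ (_) s), iff_true_intro (Finset.mem_univ s)]
  split_ifs with hπ
  · have hk : Setoid.ker (fun j : Fin n => j.1.succPNat) = π := by
      rw [hπ]
      refine Setoid.ext fun i j => ?_
      rw [Setoid.ker_def, Nat.succPNat_inj, Fin.val_inj]
      rfl
    rw [← hk, key, Finset.sum_eq_single (Equiv.refl _)]
    · refine if_pos fun i j hij => ?_
      exact Nat.succPNat_strictMono hij
    · intro s _ hs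
      refine if_neg fun hmono => hs ?_
      have hs' : StrictMono s := fun i j hij => by
        have := hmono hij
        rwa [Nat.succPNat_lt_succPNat] at this
      -- The identity is the only order automorphism of `Fin n`.
      have := Subsingleton.elim (hs'.orderIsoOfSurjective _ s.surjective) (OrderIso.refl _)
      ext i
      have := congrArg (fun e : Fin n ≃o Fin n => (e i).1) this
      simpa using this
    · simp
  · obtain ⟨f, rfl⟩ := exists_ker_eq π
    rw [key]
    refine Finset.sum_eq_zero fun s _ => if_neg fun hmono => hπ ?_
    rw [Setoid.ker_eq_bot_iff]
    have : f = (fun j => f (s j)) ∘ s.symm := by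
      ext j
      simp
    rw [this]
    exact hmono.injective.comp s.symm.injective

open scoped Classical in
/-- The Möbius function of the partition lattice counts permutations with signs. -/
theorem mu_bot_eq_sum {n : ℕ} (τ : SetPartition n) :
    IncidenceAlgebra.mu ℂ ⊥ τ =
      ∑ σ : Equiv.Perm (Fin n) with permType (Equiv.refl _) σ = τ, (-1 : ℂ) ^ permPhi ⊤ σ := by
  have h := IncidenceAlgebra.moebius_inversion_bot (𝕜 := ℂ)
    (fun τ : SetPartition n => ∑ σ : Equiv.Perm (Fin n) with permType (Equiv.refl _) σ = τ,
      (-1 : ℂ) ^ permPhi ⊤ σ) (fun π => if π = ⊥ then 1 else 0) (fun π => by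
      rw [← sum_permType_le_eq, ← Finset.sum_fiberwise_of_maps_to
        (g := fun σ => permType (Equiv.refl _) σ) (t := Finset.Iic π) (by simp)]
      refine Finset.sum_congr rfl fun τ hτ => Finset.sum_congr (Finset.ext fun σ => ?_)
        fun _ _ => rfl
      simp only [Finset.mem_filter, Finset.mem_univ, true_and, and_iff_right_iff_imp]
      rintro rfl
      exact Finset.mem_Iic.1 hτ) τ
  refine Eq.trans ?_ h.symm
  rw [Finset.sum_eq_single ⊥]
  · simp
  · intro b _ hb
    simp [hb]
  · simp

/-- Choose a cyclic permutation of each block and glue them: `σ` acts on `j` by the permutation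
chosen for the block of `j`. -/
theorem exists_permType_eq {n : ℕ} (τ : SetPartition n) :
    ∃ σ : Equiv.Perm (Fin n), permType (Equiv.refl _) σ = τ := by
  classical
  have hex : ∀ q : Quotient τ, ∃ f : Equiv.Perm (Fin n),
      f.IsCycleOn (Finset.univ.filter fun j => (⟦j⟧ : Quotient τ) = q : Finset (Fin n)) := by
    intro q
    obtain ⟨f, hf, _⟩ := Finset.exists_cycleOn
      (Finset.univ.filter fun j => (⟦j⟧ : Quotient τ) = q)
    exact ⟨f, hf⟩
  choose f hf using hex
  have hmem : ∀ (q : Quotient τ) (j : Fin n), (⟦f q j⟧ : Quotient τ) = q ↔ ⟦j⟧ = q := by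
    intro q j
    simpa using (hf q).apply_mem_iff (x := j)
  have hinj : Function.Injective fun j : Fin n => f ⟦j⟧ j := by
    intro i j hij
    have hij : f ⟦i⟧ i = f ⟦j⟧ j := hij
    have h1 : (⟦i⟧ : Quotient τ) = ⟦j⟧ := by
      rw [← (hmem ⟦i⟧ i).2 rfl, hij, (hmem ⟦j⟧ j).2 rfl]
    rw [h1] at hij
    exact (f _).injective hij
  let σ : Equiv.Perm (Fin n) := Equiv.ofBijective _ (Finite.injective_iff_bijective.1 hinj)
  have hσ : ∀ j, σ j = f ⟦j⟧ j := fun _ => rfl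
  have hpow : ∀ (j : Fin n) (k : ℕ), (σ ^ k) j = (f ⟦j⟧ ^ k) j ∧
      (⟦(σ ^ k) j⟧ : Quotient τ) = ⟦j⟧ := by
    intro j k
    induction k with
    | zero => exact ⟨rfl, rfl⟩
    | succ k ih =>
      rw [pow_succ', Equiv.Perm.mul_apply, hσ, ih.2]
      refine ⟨?_, (hmem _ _).2 ih.2⟩
      rw [ih.1, pow_succ', Equiv.Perm.mul_apply]
  refine ⟨σ, Setoid.ext fun i j => ?_⟩
  rw [permType_refl_rel]
  constructor
  · intro h
    obtain ⟨k, rfl⟩ := h.exists_nat_pow_eq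
    exact τ.symm (Quotient.exact (hpow i k).2)
  · intro h
    have hs : (f ⟦i⟧).SameCycle i j := (hf ⟦i⟧).2 (by simp)
      (by simpa using (Quotient.sound (τ.symm h) : (⟦j⟧ : Quotient τ) = ⟦i⟧))
    obtain ⟨k, hk⟩ := hs.exists_nat_pow_eq
    exact ⟨k, by rw [zpow_natCast, (hpow i k).1, hk]⟩

/-- All terms of `mu_bot_eq_sum` carry the same sign, and there is at least one. -/
theorem mu_bot_ne_zero {n : ℕ} (τ : SetPartition n) :
    IncidenceAlgebra.mu ℂ ⊥ τ ≠ 0 := by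
  classical
  obtain ⟨σ, rfl⟩ := exists_permType_eq τ
  rw [mu_bot_eq_sum, Finset.sum_congr rfl fun ρ hρ => by
    rw [permPhi_top_congr (Finset.mem_filter.1 hρ).2], Finset.sum_const]
  refine smul_ne_zero (Finset.card_ne_zero.2 ⟨σ, by simp⟩) (pow_ne_zero _ (by simp))

/-! ### Expansions of series -/

theorem ncMonomial_apply {n : ℕ} (i : Fin n → ℕ+) (w : FreeMonoid ℕ+) [Decidable
    (w = FreeMonoid.ofList (List.ofFn i))] :
    ncMonomial i w = if w = FreeMonoid.ofList (List.ofFn i) then 1 else 0 := by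
  simp only [ncMonomial, Pi.single_apply]
  congr

theorem ncMonomial_apply_ofFn {n : ℕ} (i k : Fin n → ℕ+) [Decidable (k = i)] :
    ncMonomial i (FreeMonoid.ofList (List.ofFn k)) = if k = i then 1 else 0 := by
  classical
  rw [ncMonomial_apply]
  simp only [EmbeddingLike.apply_eq_iff_eq, List.ofFn_inj]

theorem ncMonomial_apply_of_length_ne {n : ℕ} (i : Fin n → ℕ+) {w : FreeMonoid ℕ+}
    (hw : w.length ≠ n) : ncMonomial i w = 0 := by
  classical
  rw [ncMonomial_apply, if_neg]
  rintro rfl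
  exact hw (by simp [FreeMonoid.length])

theorem ncSum_ncMonomial_apply_ofFn {n : ℕ} (p : (Fin n → ℕ+) → Prop) (k : Fin n → ℕ+)
    [Decidable (p k)] :
    ncSum (fun i : {i : Fin n → ℕ+ // p i} => ncMonomial i.1)
      (FreeMonoid.ofList (List.ofFn k)) = if p k then 1 else 0 := by
  classical
  simp only [ncSum, ncMonomial_apply_ofFn]
  split_ifs with h
  · rw [finsum_eq_single _ ⟨k, h⟩, if_pos rfl]
    exact fun i hi => if_neg fun hk => hi (Subtype.ext hk.symm)
  · exact finsum_eq_zero_of_forall_eq_zero fun i => if_neg fun hk => h (by rw [hk]; exact i.2)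

theorem ncSum_apply_of_forall {ι : Type*} {F : ι → NCSeries} {w : FreeMonoid ℕ+}
    (h : ∀ a, F a w = 0) : ncSum F w = 0 :=
  finsum_eq_zero_of_forall_eq_zero h

open scoped Classical in
theorem ncM_apply_ofFn {n : ℕ} (π : SetPartition n) (k : Fin n → ℕ+) :
    ncM π (FreeMonoid.ofList (List.ofFn k)) = if Setoid.ker k = π then 1 else 0 := by
  rw [ncM, ncSum_ncMonomial_apply_ofFn]
  exact if_congr (by simp only [Setoid.ext_iff, Setoid.ker_def]) rfl rfl

open scoped Classical in
theorem ncE_apply_ofFn {n : ℕ} (π : SetPartition n) (k : Fin n → ℕ+) :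
    ncE π (FreeMonoid.ofList (List.ofFn k)) = if π ⊓ Setoid.ker k = ⊥ then 1 else 0 := by
  rw [ncE, ncSum_ncMonomial_apply_ofFn]
  congr 1
  rw [eq_bot_iff, eq_iff_iff]
  constructor
  · intro h i j hij
    by_contra hne
    exact h i j hne hij.1 hij.2
  · exact fun h i j hne hij hk => hne (h ⟨hij, hk⟩)

theorem ncM_apply_of_length_ne {n : ℕ} (π : SetPartition n) {w : FreeMonoid ℕ+}
    (hw : w.length ≠ n) : ncM π w = 0 :=
  ncSum_apply_of_forall fun _ => ncMonomial_apply_of_length_ne _ hw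

/-- A homogeneous series whose coefficients depend only on the kernel of a word. -/
theorem eq_sum_smul_ncM {n : ℕ} {F : NCSeries} (g : SetPartition n → ℂ)
    (h : ∀ k : Fin n → ℕ+, F (FreeMonoid.ofList (List.ofFn k)) = g (Setoid.ker k))
    (h0 : ∀ w : FreeMonoid ℕ+, w.length ≠ n → F w = 0) : F = ∑ π, g π • ncM π := by
  classical
  ext w
  rw [Finset.sum_apply]
  by_cases hw : w.length = n
  · obtain ⟨k, rfl⟩ : ∃ k : Fin n → ℕ+, w = FreeMonoid.ofList (List.ofFn k) := by
      subst hw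
      exact ⟨fun j => w.toList.get j, (congrArg FreeMonoid.ofList (List.ofFn_get w.toList)).symm⟩
    simp [h, ncM_apply_ofFn]
  · rw [h0 w hw]
    simp [ncM_apply_of_length_ne _ hw]

/-! ### Power sums and changes of basis -/

open scoped Classical in
/-- The power sum function `p_τ`, the sum of all `m_π` with `τ ≤ π`. -/
noncomputable def ncP {n : ℕ} (τ : SetPartition n) : NCSeries :=
  ∑ π with τ ≤ π, ncM π

/-- The coefficient of $m_\rho$ in $e_\pi$ is $1$ or $0$ according to whether
$\pi\wedge\rho=\widehat 0$, which is $\sum_{\tau\le\pi\wedge\rho}\mu(\widehat 0,\tau)$; and $m_\rho$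
occurs in $p_\tau$ exactly when $\tau\le\rho$. -/
theorem ncE_eq_sum_ncP {n : ℕ} (π : SetPartition n) :
    ncE π = ∑ τ ∈ Finset.Iic π, IncidenceAlgebra.mu ℂ ⊥ τ • ncP τ := by
  classical
  rw [eq_sum_smul_ncM (F := ncE π) (fun ρ => if π ⊓ ρ = ⊥ then 1 else 0) (ncE_apply_ofFn π)
    fun w hw => ncSum_apply_of_forall fun _ => ncMonomial_apply_of_length_ne _ hw]
  simp only [ncP, Finset.smul_sum, Finset.sum_filter]
  rw [Finset.sum_comm]
  refine Finset.sum_congr rfl fun ρ _ => ?_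
  have := IncidenceAlgebra.sum_Icc_mu_right (𝕜 := ℂ) (⊥ : SetPartition n) (π ⊓ ρ)
  simp only [eq_comm (a := (⊥ : SetPartition n))] at this
  rw [← this, Finset.sum_smul]
  simp only [smul_ite, smul_zero]
  rw [← Finset.sum_filter]
  refine Finset.sum_congr (Finset.ext fun τ => ?_) fun _ _ => rfl
  simp

/-- Möbius inversion of `ncE_eq_sum_ncP`, carried out on each coefficient with $\mu(\widehat
0,\tau)p_\tau$ as the unknown. -/
theorem mu_smul_ncP {n : ℕ} (τ : SetPartition n) :
    IncidenceAlgebra.mu ℂ ⊥ τ • ncP τ =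
      ∑ π ∈ Finset.Iic τ, IncidenceAlgebra.mu ℂ π τ • ncE π := by
  ext w
  have := IncidenceAlgebra.moebius_inversion_bot (𝕜 := ℂ)
    (fun τ : SetPartition n => IncidenceAlgebra.mu ℂ ⊥ τ * ncP τ w) (fun π => ncE π w)
    (fun π => by rw [ncE_eq_sum_ncP, Finset.sum_apply]; rfl) τ
  rw [Finset.sum_apply]
  exact this

theorem ncP_eq_sum_ncE {n : ℕ} (τ : SetPartition n) :
    ncP τ = ∑ π ∈ Finset.Iic τ,
      (IncidenceAlgebra.mu ℂ π τ / IncidenceAlgebra.mu ℂ ⊥ τ) • ncE π := by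
  rw [← inv_smul_smul₀ (mu_bot_ne_zero τ) (ncP τ), mu_smul_ncP, Finset.smul_sum]
  refine Finset.sum_congr rfl fun π _ => ?_
  rw [smul_smul, div_eq_inv_mul]

theorem ncM_eq_sum_ncP {n : ℕ} (π : SetPartition n) :
    ncM π = ∑ τ ∈ Finset.Ici π, IncidenceAlgebra.mu ℂ π τ • ncP τ := by
  classical
  ext w
  have := IncidenceAlgebra.moebius_inversion_top (𝕜 := ℂ)
    (fun π : SetPartition n => ncM π w) (fun τ => ncP τ w)
    (fun τ => by
      rw [ncP, Finset.sum_apply]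
      exact Finset.sum_congr (Finset.ext fun π => by simp) fun _ _ => rfl) π
  rw [Finset.sum_apply]
  exact this

theorem linearIndependent_ncM {n : ℕ} : LinearIndependent ℂ (ncM (n := n)) := by
  classical
  rw [Fintype.linearIndependent_iff]
  intro g hg π
  obtain ⟨k, rfl⟩ := exists_ker_eq π
  have := congrFun hg (FreeMonoid.ofList (List.ofFn k))
  rw [Finset.sum_apply] at this
  simpa [ncM_apply_ofFn] using this

theorem ncM_mem {n : ℕ} (π : SetPartition n) : ncM π ∈ NCSym n :=
  Submodule.subset_span ⟨π, rfl⟩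

theorem ncP_mem {n : ℕ} (τ : SetPartition n) : ncP τ ∈ NCSym n :=
  Submodule.sum_mem _ fun π _ => ncM_mem π

theorem ncE_mem {n : ℕ} (π : SetPartition n) : ncE π ∈ NCSym n := by
  rw [ncE_eq_sum_ncP]
  exact Submodule.sum_mem _ fun τ _ => Submodule.smul_mem _ _ (ncP_mem τ)

theorem NCSym_le_span_ncE (n : ℕ) : NCSym n ≤ Submodule.span ℂ (Set.range (ncE (n := n))) := by
  rw [NCSym, Submodule.span_le]
  rintro _ ⟨π, rfl⟩
  rw [ncM_eq_sum_ncP]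
  refine Submodule.sum_mem _ fun τ _ => Submodule.smul_mem _ _ ?_
  rw [ncP_eq_sum_ncE]
  exact Submodule.sum_mem _ fun ρ _ => Submodule.smul_mem _ _ (Submodule.subset_span ⟨ρ, rfl⟩)

theorem exists_basis_ncM (n : ℕ) :
    ∃ b : Module.Basis (SetPartition n) ℂ (NCSym n), ∀ π, (b π : NCSeries) = ncM π :=
  ⟨Module.Basis.span linearIndependent_ncM, fun π =>
    congrArg Subtype.val (Module.Basis.span_apply linearIndependent_ncM π)⟩

/-- The $e_\pi$ span, through the $p_\tau$, and there are as many of them as elements in the basis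
of the $m_\pi$; independence follows by dimension. -/
theorem exists_basis_ncE (n : ℕ) :
    ∃ b : Module.Basis (SetPartition n) ℂ (NCSym n), ∀ π, (b π : NCSeries) = ncE π := by
  obtain ⟨bm, -⟩ := exists_basis_ncM n
  have hspan : ⊤ ≤ Submodule.span ℂ
      (Set.range fun π : SetPartition n => (⟨ncE π, ncE_mem π⟩ : NCSym n)) := by
    rintro ⟨x, hx⟩ -
    have := NCSym_le_span_ncE n hx
    rw [Submodule.mem_span_range_iff_exists_fun] at this ⊢
    obtain ⟨c, hc⟩ := this
    exact ⟨c, Subtype.ext (by simpa using hc)⟩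
  refine ⟨basisOfTopLeSpanOfCardEqFinrank _ hspan
    (Module.finrank_eq_card_basis bm).symm, fun π => ?_⟩
  rw [coe_basisOfTopLeSpanOfCardEqFinrank]

theorem repr_of_eq_sum {n : ℕ} {b : Module.Basis (SetPartition n) ℂ (NCSym n)}
    {u : SetPartition n → NCSeries} (hb : ∀ π, (b π : NCSeries) = u π) {x : NCSeries}
    (hx : x ∈ NCSym n) {c : SetPartition n → ℂ} (h : x = ∑ π, c π • u π) (π : SetPartition n) :
    b.repr ⟨x, hx⟩ π = c π := by
  have : (⟨x, hx⟩ : NCSym n) = ∑ ρ, c ρ • b ρ := Subtype.ext (by simp [h, hb])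
  rw [this, b.repr_sum_self]

/-! ### The Redei–Berge function -/

section

variable {V : Type*} [Fintype V] {n : ℕ} (X : Digraph V) (v : Fin n ≃ V)

theorem redeiBerge_eq_sum_ncM :
    redeiBerge X v = ∑ π : SetPartition n,
      (∑ σ ∈ digraphPerms X with permType v σ ≤ π, (-1 : ℂ) ^ permPhi X σ) • ncM π := by
  classical
  refine eq_sum_smul_ncM _ (fun k => ?_) fun w hw => ?_
  · rw [redeiBerge, ncSum]
    simp only [← Finset.sum_smul, Pi.smul_apply, ncMonomial_apply_ofFn]
    -- The word spells out the colors of $v_1,\dots,v_n$, so exactly one coloring produces it.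
    rw [finsum_eq_single _ (k ∘ v.symm)]
    · rw [if_pos (by ext; simp), smul_eq_mul, mul_one]
      have h := sum_isFriendly X v (k ∘ v.symm)
      simp only [Function.comp_apply, v.symm_apply_apply] at h
      convert h
    · intro f hf
      rw [if_neg, smul_zero]
      rintro rfl
      exact hf (by ext; simp)
  · refine ncSum_apply_of_forall fun f => ?_
    rw [← Finset.sum_smul, Pi.smul_apply, ncMonomial_apply_of_length_ne _ hw, smul_zero]

/-- Exchange the sums over `σ` and `π`: a fixed `σ` collects all $m_\pi$ with
$\mathrm{Type}(\sigma)\le\pi$. -/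
theorem redeiBerge_eq_sum_ncP :
    redeiBerge X v = ∑ σ ∈ digraphPerms X, (-1 : ℂ) ^ permPhi X σ • ncP (permType v σ) := by
  classical
  rw [redeiBerge_eq_sum_ncM]
  simp only [ncP, Finset.smul_sum, Finset.sum_smul, Finset.sum_filter]
  rw [Finset.sum_comm]
  refine Finset.sum_congr rfl fun σ _ => Finset.sum_congr rfl fun π _ => ?_
  split_ifs <;> simp

theorem redeiBerge_eq_sum_ncE :
    redeiBerge X v = ∑ π : SetPartition n,
      (∑ σ ∈ digraphPerms X with π ≤ permType v σ,
        (-1 : ℂ) ^ permPhi X σ * IncidenceAlgebra.mu ℂ π (permType v σ) /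
          IncidenceAlgebra.mu ℂ ⊥ (permType v σ)) • ncE π := by
  rw [redeiBerge_eq_sum_ncP]
  simp only [ncP_eq_sum_ncE, Finset.smul_sum, Finset.sum_smul, smul_smul]
  rw [Finset.sum_comm' (t' := Finset.univ) (s' := fun π => {σ ∈ digraphPerms X |
    π ≤ permType v σ}) fun σ π => by simp]
  simp only [mul_div_assoc]

theorem redeiBerge_mem : redeiBerge X v ∈ NCSym n := by
  rw [redeiBerge_eq_sum_ncM]
  exact Submodule.sum_mem _ fun π _ => Submodule.smul_mem _ _ (ncM_mem π)

end

theorem mainTheorem9 {V : Type*} [Fintype V] {n : ℕ} (X : Digraph V) (v : Fin n ≃ V) :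
    ∃ (bm be : Module.Basis (SetPartition n) ℂ (NCSym n)),
      (∀ π, (bm π : NCSeries) = ncM π) ∧
      (∀ π, (be π : NCSeries) = ncE π) ∧
      ∃ hW : redeiBerge X v ∈ NCSym n,
        (∀ π : SetPartition n,
          bm.repr ⟨redeiBerge X v, hW⟩ π =
            ∑ σ ∈ digraphPerms X with permType v σ ≤ π, (-1 : ℂ) ^ permPhi X σ) ∧
        (∀ π : SetPartition n,
          be.repr ⟨redeiBerge X v, hW⟩ π =
            ∑ σ ∈ digraphPerms X with π ≤ permType v σ,
              (-1 : ℂ) ^ permPhi X σ * IncidenceAlgebra.mu ℂ π (permType v σ) /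
                IncidenceAlgebra.mu ℂ ⊥ (permType v σ)) := by
  obtain ⟨bm, hbm⟩ := exists_basis_ncM n
  obtain ⟨be, hbe⟩ := exists_basis_ncE n
  exact ⟨bm, be, hbm, hbe, redeiBerge_mem X v,
    repr_of_eq_sum hbm _ (redeiBerge_eq_sum_ncM X v),
    repr_of_eq_sum hbe _ (redeiBerge_eq_sum_ncE X v)⟩
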